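/- Let $p\ge 5$ be prime and let $\mathbb Z_{(p)}$ be the ring of $p$-integral rational numbers. For an integer $k\ge 0$ let $M_k\subset \mathbb Z_{(p)}[[q]]$ be the set of Fourier expansions of modular forms of weight $k$ on $\mathrm{SL}_2(\mathbb Z)$ with Fourier coefficients in $\mathbb Z_{(p)}$, and interpret congruences between power series modulo $p^m$ (that is, modulo $p^m\mathbb Z_{(p)}$) coefficientwise. For even $k\ge 2$ let $G_k=-\frac{B_k}{2k}+\sum_{n\ge1}\sigma_{k-1}(n)q^n=-\frac{B_k}{2k}E_k$, where $B_k$ is the $k$-th Bernoulli number and $\sigma_{k-1}(n)=\sum_{d\mid n}d^{k-1}$. For $m\ge 1$ define the mod $p^m$ factor filtration of $f$ by $$\tilde\omega_{p^m}(f)=\inf\{k\ge 0:\ f\equiv E_{p-1}^n\,g \pmod{p^m}\ \text{for some } n\ge 0 \text{ and some } g\in M_k\},$$ where the infimum of the empty set is $\infty$. Let $m\ge 1$ and let $k\ge 4$ be an even integer with $(p-1)\nmid k$. Let $k_0(m)$ be the least integer greater than $m$ that is congruent to $k$ modulo $p-1$. If $m=1$, assume in addition that $k\not\equiv 2\pmod{p-1}$.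 Then $G_k\in M_k$ and $$\tilde\omega_{p^m}(G_k)\le (m-1)(p-1)+k_0(m).$$ In particular, there are an integer $w$ with $0\le w\le mp$, an integer $n\ge 0$ and a form $g\in M_w$ such that $G_k\equiv E_{p-1}^n\,g\pmod{p^m}$. -/

import Mathlib

open scoped MatrixGroups PowerSeries

noncomputable section

namespace EisFactor

/-- The ring `ℤ_(p)` of `p`-integral rational numbers, as a set: the rationals whose reduced
denominator is prime to `p` (for `p` prime). -/
def pIntegers (p : ℕ) : Set ℚ := {x | ¬ p ∣ x.den}

/-- `G_k = -B_k/(2k) + ∑_{n ≥ 1} σ_{k-1}(n) q^n`. -/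
def eisG (k : ℕ) : ℚ⟦X⟧ :=
  PowerSeries.mk fun n =>
    if n = 0 then -(bernoulli k) / (2 * k) else (ArithmeticFunction.sigma (k - 1) n : ℚ)

/-- `E_k = 1 - (2k/B_k) ∑_{n ≥ 1} σ_{k-1}(n) q^n`, so that `G_k = -B_k/(2k) E_k` for even `k ≥ 2`;
moreover `E_0 = 1`. -/
def eisE (k : ℕ) : ℚ⟦X⟧ :=
  PowerSeries.mk fun n =>
    if n = 0 then 1 else -(2 * k) / (bernoulli k) * (ArithmeticFunction.sigma (k - 1) n : ℚ)

/-- `M_k`: the Fourier expansions of the modular forms of weight `k` on `SL₂(ℤ)` whose Fourier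
coefficients all lie in `ℤ_(p)`. -/
def modForms (p k : ℕ) : Set ℚ⟦X⟧ :=
  {f | (∀ n, PowerSeries.coeff n f ∈ pIntegers p) ∧
    ∃ F : ModularForm 𝒮ℒ (k : ℤ),
      UpperHalfPlane.qExpansion 1 F = PowerSeries.map (algebraMap ℚ ℂ) f}

/-- Coefficientwise congruence `f ≡ g (mod p^m)`: every coefficient of `f - g` lies in
`p^m ℤ_(p)`. -/
def CongMod (p m : ℕ) (f g : ℚ⟦X⟧) : Prop :=
  ∀ n, ∃ c ∈ pIntegers p, PowerSeries.coeff n f - PowerSeries.coeff n g = (p : ℚ) ^ m * c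

/-- The mod `p^m` factor filtration: the infimum of the weights `k` such that
`f ≡ E_{p-1}^n g (mod p^m)` for some `n ≥ 0` and some `g ∈ M_k`. The infimum is taken in `ℕ∞`,
so it is `⊤` when there is no such weight. -/
def factorFiltration (p m : ℕ) (f : ℚ⟦X⟧) : ℕ∞ :=
  sInf {w : ℕ∞ | ∃ k : ℕ, w = k ∧
    ∃ n : ℕ, ∃ g ∈ modForms p k, CongMod p m f (eisE (p - 1) ^ n * g)}

/-- `k_0(m)`: the smallest integer greater than `m` and congruent to `k` modulo `p - 1`. -/
def kZero (p k m : ℕ) : ℕ := sInf {j : ℕ | m < j ∧ j ≡ k [MOD (p - 1)]}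

end EisFactor

end

/-! Write E = `E_{p-1}`; von Staudt–Clausen gives E ≡ 1 mod p. The heart is Kummer's congruence: for
r < k and (p-1) ∤ k, the r-th difference of j ↦ G_{k+j(p-1)} vanishes mod p^r
(`sum_eisG_mem_coeffIdeal`). On the σ-coefficients this is Fermat. On the constant terms B_k/(2k) it
comes from Voronoi's sums, integers tending p-adically to (c^k-1)(1-p^(k-1))B_k/k.

That difference mixes weights. With T the shift of weight by p-1, expanding (E-T)^m =
((E-1)+(1-T))^m gives terms divisible by p^i·p^(m-i), hence a relation mod p^m homogeneous in
weight. Its top coefficient is ±1, so it is a recursion expressing G_{k+m(p-1)} through the m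
preceding members times powers of E. Iterating, G_{k+s(p-1)} with s ≥ m-1 becomes E^(s-(m-1))·h with
h of weight k+(m-1)(p-1) (`exists_modForm_congr_eisG`). The only demand on the starting weight is
essentially that it exceed m, and k₀(m) is the smallest such weight in the class of k. -/

namespace EisFactor

open Filter Topology

/-! ### Bernoulli numbers as p-adic limits of Voronoi's sums -/

section Voronoi

/-- The sum of the `k`-th powers of the naturals below `p ^ N` prime to `p`. -/
def unitPowerSum (p k N : ℕ) : ℤ :=
  ∑ a ∈ (Finset.range (p ^ N)).filter (fun a => ¬ p ∣ a), (a : ℤ) ^ k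

/-- Voronoi's sum `∑ ⌊ca / p^N⌋ (ca)^(k-1)` over the `a < p ^ N` prime to `p`. -/
def voronoiSum (p c k N : ℕ) : ℤ :=
  ∑ a ∈ (Finset.range (p ^ N)).filter (fun a => ¬ p ∣ a),
    ((c * a / p ^ N : ℕ) : ℤ) * (c * a : ℤ) ^ (k - 1)

/-- Multiplication by c permutes the units mod p^N. -/
lemma sum_mul_mod_pow {p : ℕ} (hp : p.Prime) {c : ℕ} (hc : ¬ p ∣ c) (k : ℕ) {N : ℕ} (hN : N ≠ 0) :
    ∑ a ∈ (Finset.range (p ^ N)).filter (fun a => ¬ p ∣ a), ((c * a % p ^ N : ℕ) : ℤ) ^ k =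
      unitPowerSum p k N := by
  have hpos : 0 < p ^ N := pow_pos hp.pos N
  have hmaps : Set.MapsTo (fun a => c * a % p ^ N)
      ((Finset.range (p ^ N)).filter (fun a => ¬ p ∣ a))
      ((Finset.range (p ^ N)).filter (fun a => ¬ p ∣ a)) := by
    intro a ha
    simp only [Finset.coe_filter, Finset.mem_range, Set.mem_ofPred_eq] at ha ⊢
    refine ⟨Nat.mod_lt _ hpos, fun h => ?_⟩
    rw [(Nat.dvd_mod_iff (dvd_pow_self p hN))] at h
    exact (hp.dvd_mul.mp h).elim hc ha.2
  have hinj : Set.InjOn (fun a => c * a % p ^ N)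
      ((Finset.range (p ^ N)).filter (fun a => ¬ p ∣ a)) := by
    intro a ha b hb hab
    simp only [Finset.coe_filter, Finset.mem_range, Set.mem_ofPred_eq] at ha hb
    have hcop : Nat.gcd (p ^ N) c = 1 :=
      (((Nat.Prime.coprime_iff_not_dvd hp).2 hc).pow_left N)
    have h : a ≡ b [MOD p ^ N] := Nat.ModEq.cancel_left_of_coprime hcop hab
    exact Nat.ModEq.eq_of_lt_of_lt h ha.1 hb.1
  exact Finset.sum_nbij (fun a => c * a % p ^ N) hmaps hinj
    (Finset.surjOn_of_injOn_of_card_le _ hmaps hinj le_rfl) (fun _ _ => rfl)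

lemma exists_pow_sub_mul (x y : ℤ) (k : ℕ) :
    ∃ z : ℤ, (x - y) ^ k = x ^ k - k * y * x ^ (k - 1) + y ^ 2 * z := by
  obtain ⟨z, hz⟩ := Polynomial.binomExpansion (Polynomial.X ^ k : Polynomial ℤ) x (-y)
  refine ⟨z, ?_⟩
  simp [Polynomial.derivative_X_pow] at hz
  rw [sub_eq_add_neg, hz]; ring

/-- Expand (ca - p^N⌊ca/p^N⌋)^k to first order in p^N and sum over the units. -/
lemma exists_voronoi_identity {p : ℕ} (hp : p.Prime) {c : ℕ} (hc : ¬ p ∣ c) (k : ℕ) {N : ℕ}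
    (hN : N ≠ 0) : ∃ z : ℤ, unitPowerSum p k N = (c : ℤ) ^ k * unitPowerSum p k N
      - k * (p : ℤ) ^ N * voronoiSum p c k N + ((p : ℤ) ^ N) ^ 2 * z := by
  have h (a : ℕ) : ∃ z : ℤ, ((c * a % p ^ N : ℕ) : ℤ) ^ k = (c : ℤ) ^ k * (a : ℤ) ^ k
      - k * (p : ℤ) ^ N * (((c * a / p ^ N : ℕ) : ℤ) * (c * a : ℤ) ^ (k - 1))
      + ((p : ℤ) ^ N) ^ 2 * z := by
    obtain ⟨z, hz⟩ := exists_pow_sub_mul (c * a) ((p : ℤ) ^ N * ((c * a / p ^ N : ℕ) : ℤ)) k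
    refine ⟨((c * a / p ^ N : ℕ) : ℤ) ^ 2 * z, ?_⟩
    have e : ((c * a % p ^ N : ℕ) : ℤ) = c * a - (p : ℤ) ^ N * ((c * a / p ^ N : ℕ) : ℤ) := by
      have := Nat.mod_add_div (c * a) (p ^ N)
      zify at this
      push_cast
      linarith
    rw [e, hz]
    ring
  choose z hz using h
  refine ⟨∑ a ∈ (Finset.range (p ^ N)).filter (fun a => ¬ p ∣ a), z a, ?_⟩
  conv_lhs => rw [← sum_mul_mod_pow hp hc k hN]
  simp only [hz, unitPowerSum, voronoiSum, Finset.mul_sum, Finset.sum_add_distrib,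
    Finset.sum_sub_distrib]

lemma unitPowerSum_succ {p : ℕ} (hp : p.Prime) (k N : ℕ) :
    unitPowerSum p k (N + 1) = ∑ a ∈ Finset.range (p ^ (N + 1)), (a : ℤ) ^ k
      - (p : ℤ) ^ k * ∑ a ∈ Finset.range (p ^ N), (a : ℤ) ^ k := by
  rw [unitPowerSum, eq_sub_iff_add_eq,
    ← Finset.sum_filter_not_add_sum_filter (Finset.range (p ^ (N + 1))) (fun a => p ∣ a)
      (fun a : ℕ => (a : ℤ) ^ k)]
  congr 1
  rw [Finset.mul_sum]
  refine Finset.sum_nbij (fun a => p * a) ?_ ?_ ?_ ?_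
  · intro a ha
    simp only [Finset.mem_filter, Finset.mem_range] at ha ⊢
    refine ⟨?_, dvd_mul_right _ _⟩
    rw [pow_succ']
    exact Nat.mul_lt_mul_of_pos_left ha hp.pos
  · intro a _ b _ hab
    exact Nat.eq_of_mul_eq_mul_left hp.pos hab
  · rintro a ha
    simp only [Finset.coe_filter, Finset.mem_range, Set.mem_ofPred_eq] at ha
    obtain ⟨h, b, rfl⟩ := ha
    refine ⟨b, ?_, rfl⟩
    rw [pow_succ'] at h
    simpa using Nat.lt_of_mul_lt_mul_left h
  · intro a _
    push_cast
    ring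

variable (p : ℕ) [Fact p.Prime]

lemma tendsto_prime_pow_padic : Tendsto (fun N : ℕ => (p : ℚ_[p]) ^ N) atTop (𝓝 0) :=
  tendsto_pow_atTop_nhds_zero_of_norm_lt_one Padic.norm_p_lt_one

/-- By Faulhaber's formula the quotient is a polynomial in x = p^N, and x → 0 leaves its constant
term, the one with i = k. -/
lemma tendsto_sum_range_pow_div (k : ℕ) :
    Tendsto (fun N : ℕ => (∑ a ∈ Finset.range (p ^ N), (a : ℚ_[p]) ^ k) / (p : ℚ_[p]) ^ N) atTop
      (𝓝 ((bernoulli k : ℚ) : ℚ_[p])) := by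
  have hp0 : (p : ℚ_[p]) ≠ 0 := mod_cast (Fact.out : p.Prime).ne_zero
  have h (N : ℕ) : (∑ a ∈ Finset.range (p ^ N), (a : ℚ_[p]) ^ k) / (p : ℚ_[p]) ^ N =
      ∑ i ∈ Finset.range (k + 1), ((bernoulli i * (k + 1).choose i / (k + 1) : ℚ) : ℚ_[p]) *
        ((p : ℚ_[p]) ^ N) ^ (k - i) := by
    have := congrArg (fun x : ℚ => (x : ℚ_[p])) (sum_range_pow (p ^ N) k)
    push_cast at this
    rw [this, Finset.sum_div]
    refine Finset.sum_congr rfl fun i hi => ?_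
    have hi' : k + 1 - i = (k - i) + 1 := by
      have := Finset.mem_range.1 hi
      lia
    have hN : (p : ℚ_[p]) ^ N ≠ 0 := pow_ne_zero _ hp0
    rw [hi', pow_succ]
    push_cast
    field_simp
  simp only [h]
  have key : Tendsto (fun x : ℚ_[p] => ∑ i ∈ Finset.range (k + 1),
      ((bernoulli i * (k + 1).choose i / (k + 1) : ℚ) : ℚ_[p]) * x ^ (k - i)) (𝓝 0)
      (𝓝 (∑ i ∈ Finset.range (k + 1),
      ((bernoulli i * (k + 1).choose i / (k + 1) : ℚ) : ℚ_[p]) * 0 ^ (k - i))) := by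
    refine Continuous.tendsto ?_ 0
    fun_prop
  have e : ∑ i ∈ Finset.range (k + 1),
      ((bernoulli i * (k + 1).choose i / (k + 1) : ℚ) : ℚ_[p]) * 0 ^ (k - i) =
      ((bernoulli k : ℚ) : ℚ_[p]) := by
    rw [Finset.sum_range_succ, Finset.sum_eq_zero]
    · have : (k + 1 : ℚ) ≠ 0 := by positivity
      simp [Nat.choose_succ_self_right, mul_div_assoc, div_self this]
    · intro i hi
      rw [zero_pow, mul_zero]
      have := Finset.mem_range.1 hi
      lia
  rw [e] at key
  exact key.comp (tendsto_prime_pow_padic p)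

/-- `(1 - p^(k-1)) B_k / k`, the value `-ζ(1-k)` with its Euler factor at `p` removed. -/
def eulerBernoulli (p k : ℕ) : ℚ := (1 - (p : ℚ) ^ (k - 1)) * (bernoulli k / k)

/-- Divide Voronoi's identity by k·p^N; the quadratic remainder dies, and dropping multiples of p
from the power sum produces the Euler factor. -/
lemma tendsto_voronoiSum {c : ℕ} (hc : ¬ p ∣ c) {k : ℕ} (hk : k ≠ 0) :
    Tendsto (fun N : ℕ => ((voronoiSum p c k N : ℤ) : ℚ_[p])) atTop
      (𝓝 (((c : ℚ_[p]) ^ k - 1) * (eulerBernoulli p k : ℚ))) := by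
  have hp : p.Prime := Fact.out
  have hp0 : (p : ℚ_[p]) ≠ 0 := mod_cast hp.ne_zero
  have hk0 : (k : ℚ_[p]) ≠ 0 := mod_cast hk
  -- The identity needs N ≠ 0.
  rw [← tendsto_add_atTop_iff_nat 1]
  choose z hz using fun N : ℕ => exists_voronoi_identity hp hc k (Nat.succ_ne_zero N)
  have hT : Tendsto (fun N : ℕ => ((unitPowerSum p k (N + 1) : ℤ) : ℚ_[p]) / (p : ℚ_[p]) ^ (N + 1))
      atTop (𝓝 ((bernoulli k : ℚ) - (p : ℚ_[p]) ^ (k - 1) * (bernoulli k : ℚ))) := by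
    have h1 := (tendsto_add_atTop_iff_nat 1).2 (tendsto_sum_range_pow_div p k)
    have h2 := (tendsto_sum_range_pow_div p k).const_mul ((p : ℚ_[p]) ^ (k - 1))
    refine (h1.sub h2).congr fun N => ?_
    rw [unitPowerSum_succ hp]
    have hN : (p : ℚ_[p]) ^ N ≠ 0 := pow_ne_zero _ hp0
    push_cast
    obtain ⟨l, rfl⟩ := Nat.exists_eq_succ_of_ne_zero hk
    simp only [Nat.succ_eq_add_one, Nat.add_sub_cancel]
    field_simp
    ring
  have hZ : Tendsto (fun N : ℕ => (p : ℚ_[p]) ^ (N + 1) * ((z N : ℤ) : ℚ_[p])) atTop (𝓝 0) := by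
    refine squeeze_zero_norm (fun N => ?_)
      ((tendsto_zero_iff_norm_tendsto_zero).1
        ((tendsto_add_atTop_iff_nat 1).2 (tendsto_prime_pow_padic p)))
    rw [norm_mul]
    exact mul_le_of_le_one_right (norm_nonneg _) (Padic.norm_int_le_one _)
  have := ((hT.const_mul ((c : ℚ_[p]) ^ k - 1)).add hZ).div_const (k : ℚ_[p])
  convert! this.congr fun N => ?_ using 2
  · simp only [eulerBernoulli]
    push_cast
    ring
  · have hN : (p : ℚ_[p]) ^ (N + 1) ≠ 0 := pow_ne_zero _ hp0
    have e := congrArg (fun x : ℤ => (x : ℚ_[p])) (hz N)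
    simp only [Nat.succ_eq_add_one] at e
    push_cast at e
    rw [div_eq_iff hk0, ← mul_div_assoc, div_add' _ _ _ hN, div_eq_iff hN]
    linear_combination -e

end Voronoi

/-! ### Kummer's congruences for B_k/k -/

section Kummer

lemma norm_sub_le_max_of_ultrametric {M : Type*} [SeminormedAddCommGroup M] [IsUltrametricDist M]
    (x y : M) : ‖x - y‖ ≤ max ‖x‖ ‖y‖ := by
  simpa [sub_eq_add_neg] using IsUltrametricDist.norm_add_le_max x (-y)

lemma sum_alternating_choose_mul_pow {R : Type*} [CommRing R] (x : R) (r : ℕ) :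
    ∑ j ∈ Finset.range (r + 1), (-1) ^ j * (r.choose j : R) * x ^ j = (1 - x) ^ r := by
  rw [sub_eq_neg_add, add_pow]
  refine Finset.sum_congr rfl fun j _ => ?_
  rw [neg_pow x, one_pow]
  ring

/-- Under the sum over a, the alternating sum collapses to (1-(ca)^(p-1))^r, and Fermat applies. -/
lemma pow_dvd_sum_voronoiSum {p : ℕ} (hp : p.Prime) {c : ℕ} (hc : ¬ p ∣ c) {k : ℕ} (hk : k ≠ 0)
    (r N : ℕ) : (p : ℤ) ^ r ∣ ∑ j ∈ Finset.range (r + 1),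
      (-1) ^ j * (r.choose j : ℤ) * voronoiSum p c (k + j * (p - 1)) N := by
  have h : ∑ j ∈ Finset.range (r + 1),
      (-1) ^ j * (r.choose j : ℤ) * voronoiSum p c (k + j * (p - 1)) N =
      ∑ a ∈ (Finset.range (p ^ N)).filter (fun a => ¬ p ∣ a),
        ((c * a / p ^ N : ℕ) : ℤ) * (c * a : ℤ) ^ (k - 1) * (1 - (c * a : ℤ) ^ (p - 1)) ^ r := by
    simp only [voronoiSum, Finset.mul_sum]
    rw [Finset.sum_comm]
    refine Finset.sum_congr rfl fun a _ => ?_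
    rw [← sum_alternating_choose_mul_pow, Finset.mul_sum]
    refine Finset.sum_congr rfl fun j _ => ?_
    rw [show k + j * (p - 1) - 1 = (k - 1) + (p - 1) * j by rw [mul_comm j]; lia, pow_add, pow_mul]
    ring
  rw [h]
  refine Finset.dvd_sum fun a ha => Dvd.dvd.mul_left (pow_dvd_pow_of_dvd ?_ r) _
  have hca : IsCoprime (c * a : ℤ) p := by
    have : Nat.Coprime (c * a) p :=
      ((Nat.Prime.coprime_iff_not_dvd hp).2 fun h =>
        (hp.dvd_mul.mp h).elim hc (Finset.mem_filter.1 ha).2).symm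
    exact_mod_cast Nat.isCoprime_iff_coprime.2 this
  exact (Int.ModEq.pow_card_sub_one_eq_one hp hca).dvd

variable (p : ℕ) [Fact p.Prime]

/-- Such a c makes c^k-1 a unit when (p-1) ∤ k, yet constant mod p^r along k + j(p-1), so it can be
divided out of the congruences. -/
lemma exists_teichmuller_approx (r : ℕ) : ∃ c : ℕ, ¬ p ∣ c ∧ (p : ℤ) ^ r ∣ (c : ℤ) ^ (p - 1) - 1 ∧
    ∀ k : ℕ, (p : ℤ) ∣ (c : ℤ) ^ k - 1 → (p - 1) ∣ k := by
  obtain ⟨g, hg⟩ := IsCyclic.exists_generator (α := (ZMod p)ˣ)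
  have hgv : (((g : ZMod p).val : ℕ) : ZMod p) = g := ZMod.natCast_zmod_val _
  have hord : orderOf g = p - 1 := by
    rw [orderOf_eq_card_of_forall_mem_zpowers hg, Nat.card_eq_fintype_card, ZMod.card_units]
  -- Raising to the power p^r keeps the residue mod p and lifts g^(p-1) ≡ 1 to the modulus p^(r+1).
  refine ⟨(g : ZMod p).val ^ p ^ r, ?_, ?_, ?_⟩
  · intro h
    have := (Fact.out : p.Prime).dvd_of_dvd_pow h
    rw [← ZMod.natCast_eq_zero_iff, hgv] at this
    exact g.ne_zero this
  · have h1 : (p : ℤ) ∣ (((g : ZMod p).val : ℕ) : ℤ) ^ (p - 1) - 1 := by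
      rw [← ZMod.intCast_zmod_eq_zero_iff_dvd]
      push_cast
      rw [hgv, ← Units.val_pow_eq_pow_val, ← hord, pow_orderOf_eq_one]
      simp
    have h2 := dvd_sub_pow_of_dvd_sub h1 r
    rw [one_pow, ← pow_mul, mul_comm, pow_mul] at h2
    push_cast
    exact (pow_dvd_pow _ (Nat.le_succ r)).trans h2
  · intro k h
    rw [← hord, orderOf_dvd_iff_pow_eq_one]
    rw [← ZMod.intCast_zmod_eq_zero_iff_dvd] at h
    push_cast at h
    rw [hgv, ZMod.pow_card_pow, sub_eq_zero] at h
    exact Units.ext (by simpa using h)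

variable {p}

lemma norm_teichmuller_pow_sub_one {c : ℕ}
    (h : ∀ k : ℕ, (p : ℤ) ∣ (c : ℤ) ^ k - 1 → (p - 1) ∣ k) {k : ℕ} (hpk : ¬ (p - 1) ∣ k) :
    ‖(c : ℚ_[p]) ^ k - 1‖ = 1 := by
  have h1 : ((((c : ℤ) ^ k - 1 : ℤ)) : ℚ_[p]) = (c : ℚ_[p]) ^ k - 1 := by push_cast; rfl
  rw [← h1]
  refine le_antisymm (Padic.norm_int_le_one _) (not_lt.1 fun hlt => hpk (h k ?_))
  exact Padic.norm_intCast_lt_one_iff.1 hlt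

lemma norm_sum_mul_eulerBernoulli_le {c : ℕ} (hc : ¬ p ∣ c) {k : ℕ} (hk : k ≠ 0) (r : ℕ) :
    ‖∑ j ∈ Finset.range (r + 1), (-1) ^ j * (r.choose j : ℚ_[p]) *
      (((c : ℚ_[p]) ^ (k + j * (p - 1)) - 1) * (eulerBernoulli p (k + j * (p - 1)) : ℚ))‖
      ≤ (p : ℝ) ^ (-r : ℤ) := by
  have h := tendsto_finsetSum (Finset.range (r + 1)) fun j _ =>
    (tendsto_voronoiSum p hc (k := k + j * (p - 1)) (by lia)).const_mul
      ((-1) ^ j * (r.choose j : ℚ_[p]))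
  refine le_of_tendsto h.norm (Eventually.of_forall fun N => ?_)
  have := (Padic.norm_int_le_pow_iff_dvd _ r).2
    (pow_dvd_sum_voronoiSum (Fact.out : p.Prime) hc hk r N)
  push_cast at this
  exact this

lemma norm_eulerBernoulli_le_one {k : ℕ} (hpk : ¬ (p - 1) ∣ k) :
    ‖((eulerBernoulli p k : ℚ) : ℚ_[p])‖ ≤ 1 := by
  have hk : k ≠ 0 := fun h => hpk (h ▸ dvd_zero _)
  obtain ⟨c, hc, -, hck⟩ := exists_teichmuller_approx p 0
  have := norm_sum_mul_eulerBernoulli_le hc hk 0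
  simpa [norm_teichmuller_pow_sub_one hck hpk] using this

lemma not_dvd_add_mul {q k : ℕ} (h : ¬ q ∣ k) (j : ℕ) : ¬ q ∣ k + j * q :=
  fun h' => h ((Nat.dvd_add_left (dvd_mul_left q j)).1 h')

/-- Kummer's congruence, for the values with Euler factor at `p` removed. -/
lemma norm_sum_eulerBernoulli_le {k : ℕ} (hpk : ¬ (p - 1) ∣ k) (r : ℕ) :
    ‖∑ j ∈ Finset.range (r + 1), (-1) ^ j * (r.choose j : ℚ_[p]) *
      (eulerBernoulli p (k + j * (p - 1)) : ℚ)‖ ≤ (p : ℝ) ^ (-r : ℤ) := by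
  have hk : k ≠ 0 := fun h => hpk (h ▸ dvd_zero _)
  obtain ⟨c, hc, hcr, hck⟩ := exists_teichmuller_approx p r
  have h1 := norm_sum_mul_eulerBernoulli_le hc hk r
  have h2 : ‖∑ j ∈ Finset.range (r + 1), (-1) ^ j * (r.choose j : ℚ_[p]) *
      (((c : ℚ_[p]) ^ (k + j * (p - 1)) - (c : ℚ_[p]) ^ k) *
        (eulerBernoulli p (k + j * (p - 1)) : ℚ))‖ ≤ (p : ℝ) ^ (-r : ℤ) := by
    refine IsUltrametricDist.norm_sum_le_of_forall_le_of_nonneg (by positivity) fun j _ => ?_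
    have e : (-1) ^ j * (r.choose j : ℚ_[p]) * ((c : ℚ_[p]) ^ (k + j * (p - 1)) - (c : ℚ_[p]) ^ k) =
        (((-1) ^ j * (r.choose j : ℤ) *
          ((c : ℤ) ^ (k + j * (p - 1)) - (c : ℤ) ^ k) : ℤ) : ℚ_[p]) := by
      push_cast
      rfl
    rw [← mul_assoc, e, norm_mul]
    refine (mul_le_of_le_one_right (norm_nonneg _)
      (norm_eulerBernoulli_le_one (not_dvd_add_mul hpk j))).trans ?_
    rw [Padic.norm_int_le_pow_iff_dvd]
    refine Dvd.dvd.mul_left ?_ _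
    have : (c : ℤ) ^ (k + j * (p - 1)) - (c : ℤ) ^ k =
        (c : ℤ) ^ k * (((c : ℤ) ^ (p - 1)) ^ j - 1 ^ j) := by
      rw [pow_add, mul_comm j, pow_mul, one_pow]
      ring
    rw [this]
    exact (hcr.trans (sub_dvd_pow_sub_pow _ _ j)).mul_left _
  -- Replace every c^(k+j(p-1)) - 1 by c^k - 1; the error is `h2`.
  have e : ((c : ℚ_[p]) ^ k - 1) * ∑ j ∈ Finset.range (r + 1), (-1) ^ j * (r.choose j : ℚ_[p]) *
      (eulerBernoulli p (k + j * (p - 1)) : ℚ) =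
      ∑ j ∈ Finset.range (r + 1), (-1) ^ j * (r.choose j : ℚ_[p]) *
      (((c : ℚ_[p]) ^ (k + j * (p - 1)) - 1) * (eulerBernoulli p (k + j * (p - 1)) : ℚ)) -
      ∑ j ∈ Finset.range (r + 1), (-1) ^ j * (r.choose j : ℚ_[p]) *
      (((c : ℚ_[p]) ^ (k + j * (p - 1)) - (c : ℚ_[p]) ^ k) *
        (eulerBernoulli p (k + j * (p - 1)) : ℚ)) := by
    rw [Finset.mul_sum, ← Finset.sum_sub_distrib]
    exact Finset.sum_congr rfl fun j _ => by ring
  have h3 := congrArg norm e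
  rw [norm_mul, norm_teichmuller_pow_sub_one hck hpk, one_mul] at h3
  rw [h3]
  exact (norm_sub_le_max_of_ultrametric _ _).trans (max_le h1 h2)

lemma norm_bernoulli_div_le_one {k : ℕ} (hk : 2 ≤ k) (hpk : ¬ (p - 1) ∣ k) :
    ‖((bernoulli k / k : ℚ) : ℚ_[p])‖ ≤ 1 := by
  have h := norm_eulerBernoulli_le_one hpk
  have hu : ‖(1 : ℚ_[p]) - (p : ℚ_[p]) ^ (k - 1)‖ = 1 := by
    have hlt : ‖(p : ℚ_[p]) ^ (k - 1)‖ < 1 := by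
      rw [norm_pow]
      exact pow_lt_one₀ (norm_nonneg _) Padic.norm_p_lt_one (by lia)
    refine le_antisymm ?_ ?_
    · exact (norm_sub_le_max_of_ultrametric _ _).trans (max_le norm_one.le hlt.le)
    · by_contra! hcon
      have := IsUltrametricDist.norm_add_le_max ((1 : ℚ_[p]) - (p : ℚ_[p]) ^ (k - 1))
        ((p : ℚ_[p]) ^ (k - 1))
      rw [sub_add_cancel, norm_one] at this
      exact absurd this (not_le.2 (max_lt hcon hlt))
  have e : ((eulerBernoulli p k : ℚ) : ℚ_[p]) =
      (1 - (p : ℚ_[p]) ^ (k - 1)) * ((bernoulli k / k : ℚ) : ℚ_[p]) := by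
    simp [eulerBernoulli]
  rwa [e, norm_mul, hu, one_mul] at h

/-- Kummer's congruence modulo `p ^ r` for `B_k / k` with `k > r`. -/
lemma norm_sum_bernoulli_div_le {k r : ℕ} (hk : 2 ≤ k) (hpk : ¬ (p - 1) ∣ k) (hrk : r < k) :
    ‖((∑ j ∈ Finset.range (r + 1), (-1) ^ j * (r.choose j : ℚ) *
      (bernoulli (k + j * (p - 1)) / (k + j * (p - 1) : ℕ)) : ℚ) : ℚ_[p])‖ ≤
      (p : ℝ) ^ (-r : ℤ) := by
  have h2 : ‖∑ j ∈ Finset.range (r + 1), (-1) ^ j * (r.choose j : ℚ_[p]) *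
      ((p : ℚ_[p]) ^ (k + j * (p - 1) - 1) *
        ((bernoulli (k + j * (p - 1)) / (k + j * (p - 1) : ℕ) : ℚ) : ℚ_[p]))‖ ≤
      (p : ℝ) ^ (-r : ℤ) := by
    refine IsUltrametricDist.norm_sum_le_of_forall_le_of_nonneg (by positivity) fun j _ => ?_
    have e : (-1) ^ j * (r.choose j : ℚ_[p]) * (p : ℚ_[p]) ^ (k + j * (p - 1) - 1) =
        (((-1) ^ j * (r.choose j : ℤ) * (p : ℤ) ^ (k + j * (p - 1) - 1) : ℤ) : ℚ_[p]) := by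
      push_cast
      rfl
    rw [← mul_assoc, e, norm_mul]
    refine (mul_le_of_le_one_right (norm_nonneg _)
      (norm_bernoulli_div_le_one (by lia) (not_dvd_add_mul hpk j))).trans ?_
    rw [Padic.norm_int_le_pow_iff_dvd]
    -- Here r < k enters: the Euler-factor correction p^(k-1+j(p-1)) is 0 mod p^r.
    exact Dvd.dvd.mul_left (pow_dvd_pow _ (by lia)) _
  have e : ((∑ j ∈ Finset.range (r + 1), (-1) ^ j * (r.choose j : ℚ) *
      (bernoulli (k + j * (p - 1)) / (k + j * (p - 1) : ℕ)) : ℚ) : ℚ_[p]) =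
      ∑ j ∈ Finset.range (r + 1), (-1) ^ j * (r.choose j : ℚ_[p]) *
      (eulerBernoulli p (k + j * (p - 1)) : ℚ) +
      ∑ j ∈ Finset.range (r + 1), (-1) ^ j * (r.choose j : ℚ_[p]) *
      ((p : ℚ_[p]) ^ (k + j * (p - 1) - 1) *
        ((bernoulli (k + j * (p - 1)) / (k + j * (p - 1) : ℕ) : ℚ) : ℚ_[p])) := by
    rw [← Finset.sum_add_distrib, Rat.cast_sum]
    refine Finset.sum_congr rfl fun j _ => ?_
    simp only [eulerBernoulli]
    push_cast
    ring
  rw [e]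
  exact (IsUltrametricDist.norm_add_le_max _ _).trans
    (max_le (norm_sum_eulerBernoulli_le hpk r) h2)

end Kummer

/-! ### Integral modular forms and divisibility of coefficients -/

section ModForms

open UpperHalfPlane EisensteinSeries

/-- B_{2l} is a nonzero multiple of ζ(2l), and ζ has no zero with Re s ≥ 1. -/
lemma bernoulli_ne_zero_of_even {k : ℕ} (hk : Even k) (hk0 : k ≠ 0) : bernoulli k ≠ 0 := by
  obtain ⟨l, rfl⟩ := even_iff_two_dvd.1 hk
  have hl : l ≠ 0 := by lia
  intro h
  have hz := riemannZeta_two_mul_nat hl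
  rw [h, Rat.cast_zero, mul_zero, zero_div] at hz
  refine riemannZeta_ne_zero_of_one_le_re ?_ hz
  have : (1 : ℝ) ≤ 2 * l := mod_cast (by lia : 1 ≤ 2 * l)
  simpa using this

lemma qExpansion_E_eq_map {k : ℕ} (hk : 3 ≤ k) (hk2 : Even k) :
    qExpansion 1 (ModularForm.E hk) = PowerSeries.map (algebraMap ℚ ℂ) (eisE k) := by
  ext n
  rw [E_qExpansion_coeff hk hk2, PowerSeries.coeff_map, eisE, PowerSeries.coeff_mk]
  split_ifs <;> simp [neg_div]

lemma eisG_eq_smul {k : ℕ} (hk2 : Even k) (hk0 : k ≠ 0) :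
    eisG k = (-(bernoulli k) / (2 * k)) • eisE k := by
  have hB := bernoulli_ne_zero_of_even hk2 hk0
  have hk : (k : ℚ) ≠ 0 := mod_cast hk0
  ext n
  simp only [eisG, eisE, PowerSeries.coeff_mk, map_smul, smul_eq_mul]
  split_ifs
  · simp
  · field_simp

lemma exists_modularForm_eisG {k : ℕ} (hk : 3 ≤ k) (hk2 : Even k) :
    ∃ F : ModularForm 𝒮ℒ (k : ℤ), qExpansion 1 F = PowerSeries.map (algebraMap ℚ ℂ) (eisG k) := by
  refine ⟨(((-(bernoulli k) / (2 * k) : ℚ)) : ℂ) • ModularForm.E hk, ?_⟩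
  rw [FunLike.coe_smul, ModularForm.qExpansion_smul one_pos one_mem_strictPeriods_SL,
    qExpansion_E_eq_map hk hk2, eisG_eq_smul hk2 (by lia)]
  ext n
  simp

variable (p : ℕ) [Fact p.Prime]

lemma mem_pIntegers_iff {x : ℚ} : x ∈ pIntegers p ↔ ‖(x : ℚ_[p])‖ ≤ 1 := by
  rw [Padic.norm_rat_le_one_iff_padicValuation_le_one, Rat.padicValuation_le_one_iff]
  rfl

/-- The power series all of whose coefficients lie in `p ^ m ℤ_(p)`. -/
def coeffIdeal (m : ℕ) : AddSubgroup ℚ⟦X⟧ where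
  carrier := {f | ∀ n, ‖((PowerSeries.coeff n f : ℚ) : ℚ_[p])‖ ≤ (p : ℝ) ^ (-m : ℤ)}
  zero_mem' n := by
    simp only [map_zero, Rat.cast_zero, norm_zero]
    positivity
  add_mem' {f g} hf hg n := by
    rw [map_add, Rat.cast_add]
    exact (IsUltrametricDist.norm_add_le_max _ _).trans (max_le (hf n) (hg n))
  neg_mem' {f} hf n := by
    simpa using hf n

variable {p}

lemma mul_mem_coeffIdeal {a b : ℕ} {f g : ℚ⟦X⟧} (hf : f ∈ coeffIdeal p a)
    (hg : g ∈ coeffIdeal p b) : f * g ∈ coeffIdeal p (a + b) := by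
  intro n
  have hp0 : (p : ℝ) ≠ 0 := mod_cast (Fact.out : p.Prime).ne_zero
  rw [PowerSeries.coeff_mul, Rat.cast_sum]
  refine IsUltrametricDist.norm_sum_le_of_forall_le_of_nonneg (by positivity) fun i _ => ?_
  rw [Rat.cast_mul, norm_mul, Nat.cast_add, neg_add, zpow_add₀ hp0]
  exact mul_le_mul (hf _) (hg _) (norm_nonneg _) (by positivity)

lemma one_mem_coeffIdeal : (1 : ℚ⟦X⟧) ∈ coeffIdeal p 0 := by
  intro n
  rw [PowerSeries.coeff_one]
  split_ifs <;> simp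

lemma pow_mem_coeffIdeal {a : ℕ} {f : ℚ⟦X⟧} (hf : f ∈ coeffIdeal p a) (n : ℕ) :
    f ^ n ∈ coeffIdeal p (n * a) := by
  induction n with
  | zero => simpa using one_mem_coeffIdeal
  | succ n ih =>
    rw [pow_succ, Nat.succ_mul]
    exact mul_mem_coeffIdeal ih hf

lemma mul_mem_coeffIdeal_of_integral {m : ℕ} {f g : ℚ⟦X⟧} (hf : f ∈ coeffIdeal p 0)
    (hg : g ∈ coeffIdeal p m) : f * g ∈ coeffIdeal p m := by
  simpa using mul_mem_coeffIdeal hf hg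

lemma congMod_of_sub_mem {m : ℕ} {f g : ℚ⟦X⟧} (h : f - g ∈ coeffIdeal p m) : CongMod p m f g := by
  intro n
  have hp0 : (p : ℚ) ≠ 0 := mod_cast (Fact.out : p.Prime).ne_zero
  have hpm : (p : ℚ) ^ m ≠ 0 := pow_ne_zero _ hp0
  refine ⟨(PowerSeries.coeff n f - PowerSeries.coeff n g) / (p : ℚ) ^ m, ?_, by field_simp⟩
  rw [mem_pIntegers_iff]
  have := h n
  rw [map_sub] at this
  rw [Rat.cast_div, norm_div, Rat.cast_pow, Rat.cast_natCast, Padic.norm_p_pow]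
  exact div_le_one_of_le₀ this (by positivity)

/-- `modForms p k` as an additive group. -/
def modFormsSubgroup (p k : ℕ) [Fact p.Prime] : AddSubgroup ℚ⟦X⟧ where
  carrier := modForms p k
  zero_mem' := by
    refine ⟨fun n => by simp [mem_pIntegers_iff], 0, ?_⟩
    rw [map_zero]
    exact qExpansion_zero 1
  add_mem' := by
    rintro f g ⟨hf, F, hF⟩ ⟨hg, G, hG⟩
    refine ⟨fun n => ?_, F + G, ?_⟩
    · have h1 := hf n
      have h2 := hg n
      rw [mem_pIntegers_iff] at h1 h2 ⊢
      rw [map_add, Rat.cast_add]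
      exact (IsUltrametricDist.norm_add_le_max _ _).trans (max_le h1 h2)
    · rw [FunLike.coe_add, ModularForm.qExpansion_add one_pos one_mem_strictPeriods_SL, hF, hG,
        map_add]
  neg_mem' := by
    rintro f ⟨hf, F, hF⟩
    refine ⟨fun n => ?_, -F, ?_⟩
    · have h1 := hf n
      rw [mem_pIntegers_iff] at h1 ⊢
      simpa using h1
    · rw [FunLike.coe_neg, ModularForm.qExpansion_neg one_pos one_mem_strictPeriods_SL, hF,
        map_neg]

lemma modForms_subset_coeffIdeal {k : ℕ} {f : ℚ⟦X⟧} (hf : f ∈ modForms p k) :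
    f ∈ coeffIdeal p 0 := by
  intro n
  simpa using (mem_pIntegers_iff p).1 (hf.1 n)

lemma mem_modForms_of_coeffIdeal {k : ℕ} {f : ℚ⟦X⟧} (hf : f ∈ coeffIdeal p 0)
    (h : ∃ F : ModularForm 𝒮ℒ (k : ℤ), qExpansion 1 F = PowerSeries.map (algebraMap ℚ ℂ) f) :
    f ∈ modForms p k :=
  ⟨fun n => (mem_pIntegers_iff p).2 (by simpa using hf n), h⟩

lemma mul_mem_modForms {a b : ℕ} {f g : ℚ⟦X⟧} (hf : f ∈ modForms p a) (hg : g ∈ modForms p b) :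
    f * g ∈ modForms p (a + b) := by
  refine mem_modForms_of_coeffIdeal (mul_mem_coeffIdeal_of_integral
    (modForms_subset_coeffIdeal hf) (modForms_subset_coeffIdeal hg)) ?_
  obtain ⟨-, F, hF⟩ := hf
  obtain ⟨-, G, hG⟩ := hg
  refine ⟨ModularForm.mcast (by push_cast; rfl) (F.mul G), ?_⟩
  rw [ModularForm.qExpansion_mcast, ModularForm.qExpansion_mul one_pos one_mem_strictPeriods_SL,
    hF, hG, map_mul]

lemma pow_mul_mem_modForms {a b : ℕ} {f g : ℚ⟦X⟧} (hf : f ∈ modForms p a) (hg : g ∈ modForms p b)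
    (n : ℕ) : f ^ n * g ∈ modForms p (n * a + b) := by
  induction n with
  | zero => simpa using hg
  | succ n ih =>
    rw [pow_succ', mul_assoc, Nat.succ_mul, add_comm (n * a), add_assoc]
    exact mul_mem_modForms hf ih

end ModForms

/-! ### Congruences between Eisenstein series -/

section Eisenstein

variable {p : ℕ} [Fact p.Prime]

/-- In von Staudt–Clausen, -1/p is the only term that is not p-integral. -/
lemma norm_bernoulli_sub_one (hp : p ≠ 2) : ‖((bernoulli (p - 1) : ℚ) : ℚ_[p])‖ = p := by
  have hpp : p.Prime := Fact.out
  obtain ⟨l, hl⟩ := (hpp.even_sub_one hp).two_dvd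
  obtain ⟨z, hz⟩ := Bernoulli.vonStaudt_clausen l
  rw [← hl] at hz
  have hmem : p ∈ (Finset.range (p - 1 + 2)).filter (fun q => q.Prime ∧ (q - 1) ∣ p - 1) := by
    simp only [Finset.mem_filter, Finset.mem_range]
    exact ⟨by lia, hpp, dvd_rfl⟩
  rw [← Finset.add_sum_erase _ _ hmem] at hz
  have hz' := congrArg (fun x : ℚ => (x : ℚ_[p])) hz
  push_cast at hz'
  set S : ℚ_[p] := ∑ q ∈ ((Finset.range (p - 1 + 2)).filter
    (fun q => q.Prime ∧ (q - 1) ∣ p - 1)).erase p, 1 / (q : ℚ_[p]) with hS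
  have hSn : ‖S‖ ≤ 1 := by
    refine IsUltrametricDist.norm_sum_le_of_forall_le_of_nonneg zero_le_one fun q hq => ?_
    simp only [Finset.mem_erase, Finset.mem_filter] at hq
    rw [norm_div, norm_one, Padic.norm_natCast_eq_one_iff.2
      ((Nat.coprime_primes hpp hq.2.2.1).2 (Ne.symm hq.1)), div_one]
  have e : ((bernoulli (p - 1) : ℚ) : ℚ_[p]) = (z - S) + -(1 / (p : ℚ_[p])) := by
    linear_combination -hz'
  have h1 : ‖(z : ℚ_[p]) - S‖ ≤ 1 :=
    (norm_sub_le_max_of_ultrametric _ _).trans (max_le (Padic.norm_int_le_one _) hSn)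
  have h2 : ‖-(1 / (p : ℚ_[p]))‖ = p := by simp
  have hp1 : (1 : ℝ) < p := mod_cast hpp.one_lt
  rw [e, IsUltrametricDist.norm_add_eq_max_of_norm_ne_norm (by rw [h2]; linarith), h2,
    max_eq_right (h1.trans hp1.le)]

lemma eisE_sub_one_mem_coeffIdeal (hp : p ≠ 2) : eisE (p - 1) - 1 ∈ coeffIdeal p 1 := by
  intro n
  rw [map_sub, eisE, PowerSeries.coeff_mk, PowerSeries.coeff_one]
  split_ifs with hn
  · simp
  · have e : ((-(2 * ((p - 1 : ℕ) : ℚ)) / bernoulli (p - 1) *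
        (ArithmeticFunction.sigma (p - 1 - 1) n : ℚ) - 0 : ℚ) : ℚ_[p]) =
        ((-(2 * ((p - 1 : ℕ) : ℤ)) * (ArithmeticFunction.sigma (p - 1 - 1) n : ℤ) : ℤ) : ℚ_[p]) /
          ((bernoulli (p - 1) : ℚ) : ℚ_[p]) := by
      push_cast
      ring
    rw [e, norm_div, norm_bernoulli_sub_one hp, Nat.cast_one, zpow_neg_one, div_eq_mul_inv]
    exact mul_le_of_le_one_left (by positivity) (Padic.norm_int_le_one _)

lemma eisE_mem_coeffIdeal (hp : p ≠ 2) : eisE (p - 1) ∈ coeffIdeal p 0 := by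
  have h : eisE (p - 1) - 1 ∈ coeffIdeal p 0 := fun n =>
    (eisE_sub_one_mem_coeffIdeal hp n).trans (by
      have : (1 : ℝ) ≤ p := mod_cast (Fact.out : p.Prime).one_le
      simpa using inv_le_one_of_one_le₀ this)
  simpa using add_mem h one_mem_coeffIdeal

lemma eisE_mem_modForms (hp : 5 ≤ p) : eisE (p - 1) ∈ modForms p (p - 1) :=
  mem_modForms_of_coeffIdeal (eisE_mem_coeffIdeal (by lia))
    ⟨_, qExpansion_E_eq_map (by lia) ((Fact.out : p.Prime).even_sub_one (by lia))⟩

lemma norm_two_eq_one (hp : p ≠ 2) : ‖(2 : ℚ_[p])‖ = 1 := by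
  have := (Padic.norm_natCast_eq_one_iff (p := p) (n := 2)).2
    ((Nat.coprime_primes Fact.out Nat.prime_two).2 hp)
  exact_mod_cast this

/-- Each divisor d contributes d^(k-1)(1-d^(p-1))^r: the first factor serves p ∣ d, as r ≤ k-1, and
the second p ∤ d. -/
lemma pow_dvd_sum_sigma {k r n : ℕ} (hr : r < k) : (p : ℤ) ^ r ∣ ∑ j ∈ Finset.range (r + 1),
    (-1) ^ j * (r.choose j : ℤ) * (ArithmeticFunction.sigma (k + j * (p - 1) - 1) n : ℤ) := by
  have h : ∑ j ∈ Finset.range (r + 1), (-1) ^ j * (r.choose j : ℤ) *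
      (ArithmeticFunction.sigma (k + j * (p - 1) - 1) n : ℤ) =
      ∑ d ∈ n.divisors, (d : ℤ) ^ (k - 1) * (1 - (d : ℤ) ^ (p - 1)) ^ r := by
    simp only [ArithmeticFunction.sigma_apply, Nat.cast_sum, Finset.mul_sum]
    rw [Finset.sum_comm]
    refine Finset.sum_congr rfl fun d _ => ?_
    rw [← sum_alternating_choose_mul_pow, Finset.mul_sum]
    refine Finset.sum_congr rfl fun j _ => ?_
    rw [show k + j * (p - 1) - 1 = (k - 1) + (p - 1) * j by rw [mul_comm j]; lia, pow_add, pow_mul]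
    push_cast
    ring
  rw [h]
  refine Finset.dvd_sum fun d _ => ?_
  by_cases hd : p ∣ d
  · exact ((pow_dvd_pow (p : ℤ) (by lia : r ≤ k - 1)).trans
      (pow_dvd_pow_of_dvd (Int.natCast_dvd_natCast.2 hd) _)).mul_right _
  · refine Dvd.dvd.mul_left (pow_dvd_pow_of_dvd ?_ r) _
    have hcop : IsCoprime (d : ℤ) p :=
      Nat.isCoprime_iff_coprime.2 ((Nat.Prime.coprime_iff_not_dvd Fact.out).2 hd).symm
    exact (Int.ModEq.pow_card_sub_one_eq_one Fact.out hcop).dvd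

/-- Kummer's congruence for the Eisenstein series `G_k`, modulo `p ^ r` with `r < k`. -/
lemma sum_eisG_mem_coeffIdeal (hp : p ≠ 2) {k r : ℕ} (hk : 2 ≤ k) (hpk : ¬ (p - 1) ∣ k)
    (hrk : r < k) : ∑ j ∈ Finset.range (r + 1), ((-1) ^ j * (r.choose j : ℤ)) •
      eisG (k + j * (p - 1)) ∈ coeffIdeal p r := by
  intro n
  simp only [map_sum, map_zsmul, eisG, PowerSeries.coeff_mk]
  by_cases hn : n = 0
  · simp only [hn, if_true]
    have e : ∑ j ∈ Finset.range (r + 1), ((-1) ^ j * (r.choose j : ℤ)) •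
        (-bernoulli (k + j * (p - 1)) / (2 * ((k + j * (p - 1) : ℕ) : ℚ))) =
        (-(∑ j ∈ Finset.range (r + 1), (-1) ^ j * (r.choose j : ℚ) *
      (bernoulli (k + j * (p - 1)) / (k + j * (p - 1) : ℕ)))) / 2 := by
      rw [← Finset.sum_neg_distrib, Finset.sum_div]
      refine Finset.sum_congr rfl fun j _ => ?_
      rw [zsmul_eq_mul]
      push_cast
      field_simp
    rw [e, Rat.cast_div, Rat.cast_neg, norm_div, norm_neg, Rat.cast_ofNat, norm_two_eq_one hp,
      div_one]
    exact norm_sum_bernoulli_div_le hk hpk hrk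
  · simp only [hn, if_false]
    have := (Padic.norm_int_le_pow_iff_dvd _ r).2 (pow_dvd_sum_sigma (p := p) (n := n) hrk)
    push_cast at this
    push_cast [zsmul_eq_mul]
    exact this

lemma eisG_mem_modForms (hp : p ≠ 2) {k : ℕ} (hk : 3 ≤ k) (hk2 : Even k) (hpk : ¬ (p - 1) ∣ k) :
    eisG k ∈ modForms p k := by
  refine mem_modForms_of_coeffIdeal ?_ (exists_modularForm_eisG hk hk2)
  simpa using sum_eisG_mem_coeffIdeal (r := 0) hp (by lia) hpk (by lia)

/-! ### Twisted differences via the shift operator -/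

section Shift

variable {R : Type*} [CommRing R]

/-- The binomial theorem for (y - T)^m, T the shift of sequences: T is R-linear, so it commutes with
the scalar y. -/
lemma smul_sub_shift_pow_apply (y : R) (u : ℕ → R) (m : ℕ) :
    ((algebraMap R (Module.End R (ℕ → R)) y - LinearMap.funLeft R R Nat.succ) ^ m) u 0 =
      ∑ j ∈ Finset.range (m + 1), ((-1) ^ j * (m.choose j : ℤ)) • (y ^ (m - j) * u j) := by
  have hT (j : ℕ) (v : ℕ → R) (n : ℕ) :
      ((LinearMap.funLeft R R Nat.succ : Module.End R (ℕ → R)) ^ j) v n = v (n + j) := by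
    induction j generalizing n with
    | zero => simp
    | succ j ih =>
      rw [pow_succ', Module.End.mul_apply, LinearMap.funLeft_apply, ih]
      congr 1
      lia
  have hc : Commute (-(LinearMap.funLeft R R Nat.succ : Module.End R (ℕ → R)))
      (algebraMap R (Module.End R (ℕ → R)) y) := Algebra.commute_algebraMap_right _ _
  rw [sub_eq_neg_add, hc.add_pow, LinearMap.sum_apply, Finset.sum_apply]
  refine Finset.sum_congr rfl fun j _ => ?_
  have hneg : (-(LinearMap.funLeft R R Nat.succ : Module.End R (ℕ → R))) ^ j =
      ((-1) ^ j : R) • (LinearMap.funLeft R R Nat.succ : Module.End R (ℕ → R)) ^ j := by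
    rw [← neg_one_smul R, smul_pow]
  rw [hneg]
  simp only [Module.End.mul_apply, Module.End.natCast_apply, ← map_pow,
    Module.algebraMap_end_apply, LinearMap.smul_apply, Pi.smul_apply, hT, zero_add]
  simp only [smul_eq_mul, zsmul_eq_mul, nsmul_eq_mul]
  push_cast
  ring

/-- Comparison of the `m`-th differences twisted by `x + y` with those twisted by `y`. -/
lemma sum_twisted_difference (x y : R) (u : ℕ → R) (m : ℕ) :
    ∑ j ∈ Finset.range (m + 1), ((-1) ^ j * (m.choose j : ℤ)) • ((x + y) ^ (m - j) * u j) =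
      ∑ i ∈ Finset.range (m + 1), m.choose i • (x ^ i *
        ∑ j ∈ Finset.range (m - i + 1),
          ((-1) ^ j * ((m - i).choose j : ℤ)) • (y ^ (m - i - j) * u j)) := by
  simp only [← smul_sub_shift_pow_apply]
  -- (x + y) - T = x + (y - T), with x central.
  rw [map_add, add_sub_assoc, (Algebra.commute_algebraMap_left _ _).add_pow, LinearMap.sum_apply,
    Finset.sum_apply]
  refine Finset.sum_congr rfl fun i _ => ?_
  rw [← (Nat.cast_commute (m.choose i) _).eq, ← map_pow]
  simp only [Module.End.mul_apply, Module.End.natCast_apply, Module.algebraMap_end_apply,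
    Pi.smul_apply, smul_eq_mul]

end Shift

/-- Kummer's congruence for the Eisenstein series, homogenized in weight by powers of `E_{p-1}`. -/
lemma sum_eisE_pow_mul_eisG_mem_coeffIdeal (hp : p ≠ 2) {k m : ℕ} (hk : 2 ≤ k)
    (hpk : ¬ (p - 1) ∣ k) (hmk : m < k) : ∑ j ∈ Finset.range (m + 1),
      ((-1) ^ j * (m.choose j : ℤ)) • (eisE (p - 1) ^ (m - j) * eisG (k + j * (p - 1))) ∈
        coeffIdeal p m := by
  have h := sum_twisted_difference (eisE (p - 1) - 1) 1 (fun j => eisG (k + j * (p - 1))) m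
  rw [sub_add_cancel] at h
  rw [h]
  refine sum_mem fun i hi => nsmul_mem ?_ _
  have hi' : i ≤ m := by simpa [Nat.lt_succ_iff] using hi
  -- (E-1)^i supplies p^i and Kummer's congruence supplies p^(m-i).
  have h1 := mul_mem_coeffIdeal (pow_mem_coeffIdeal (eisE_sub_one_mem_coeffIdeal hp) i)
    (sum_eisG_mem_coeffIdeal (r := m - i) hp hk hpk (by lia))
  rw [mul_one, Nat.add_sub_cancel' hi'] at h1
  simpa using h1

/-- Reduction of the weight of `G_{k + s(p-1)}` modulo `p ^ m` to `k + (m-1)(p-1)`, by division by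
powers of `E_{p-1}`. -/
lemma exists_modForm_congr_eisG (hp : 5 ≤ p) {k m : ℕ} (hm : 1 ≤ m) (hk : 3 ≤ k) (hk2 : Even k)
    (hpk : ¬ (p - 1) ∣ k) (hmk : m < k) (s : ℕ) :
    ∃ h ∈ modForms p (k + (m - 1) * (p - 1)), ∀ t, s ≤ t → m - 1 ≤ t →
      eisE (p - 1) ^ (t - s) * eisG (k + s * (p - 1)) - eisE (p - 1) ^ (t - (m - 1)) * h ∈
        coeffIdeal p m := by
  have hp2 : p ≠ 2 := by lia
  have hpe : Even (p - 1) := (Fact.out : p.Prime).even_sub_one hp2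
  -- The free exponent t stands in for division by E: all the congruences used can be brought to a
  -- common t.
  induction s using Nat.strong_induction_on with
  | _ s ih =>
    by_cases hs : s ≤ m - 1
    · refine ⟨eisE (p - 1) ^ (m - 1 - s) * eisG (k + s * (p - 1)), ?_, fun t _ ht => ?_⟩
      · convert pow_mul_mem_modForms (eisE_mem_modForms hp)
          (eisG_mem_modForms hp2 (k := k + s * (p - 1)) (by lia) (hk2.add (hpe.mul_left s))
            (not_dvd_add_mul hpk s)) (m - 1 - s) using 2
        obtain ⟨d, hd⟩ := Nat.exists_eq_add_of_le hs
        rw [hd, Nat.add_sub_cancel_left]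
        ring
      · rw [← mul_assoc, ← pow_add, show t - (m - 1) + (m - 1 - s) = t - s by lia, sub_self]
        exact zero_mem _
    · obtain ⟨s', rfl⟩ := Nat.exists_eq_add_of_le (show m ≤ s by lia)
      choose! h hmem hcong using ih
      have hrel := sum_eisE_pow_mul_eisG_mem_coeffIdeal hp2 (k := k + s' * (p - 1)) (m := m)
        (by lia) (not_dvd_add_mul hpk s') (by lia)
      have hidx (j : ℕ) : k + s' * (p - 1) + j * (p - 1) = k + (s' + j) * (p - 1) := by ring
      simp only [hidx] at hrel
      rw [Finset.sum_range_succ, Nat.sub_self, pow_zero, one_mul, Nat.choose_self] at hrel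
      -- The relation solved for its j = m term, whose coefficient is (-1)^m, with each earlier
      -- series replaced by its reduction.
      refine ⟨-((-1) ^ m * ∑ j ∈ Finset.range m, ((-1) ^ j * (m.choose j : ℤ)) • h (s' + j)),
        ?_, fun t hst ht => ?_⟩
      · have hsum : ∑ j ∈ Finset.range m, ((-1) ^ j * (m.choose j : ℤ)) • h (s' + j) ∈
            modFormsSubgroup p (k + (m - 1) * (p - 1)) :=
          sum_mem fun j hj => zsmul_mem (hmem _ (by have := Finset.mem_range.1 hj; lia)) _
        have := neg_mem (zsmul_mem hsum ((-1) ^ m))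
        rw [zsmul_eq_mul] at this
        push_cast at this
        exact this
      · have h1 := mul_mem_coeffIdeal_of_integral
          (by simpa using pow_mem_coeffIdeal (eisE_mem_coeffIdeal hp2) (t - (m + s'))) hrel
        have h2 : ∑ j ∈ Finset.range m, ((-1) ^ j * (m.choose j : ℤ)) •
            (eisE (p - 1) ^ (t - (s' + j)) * eisG (k + (s' + j) * (p - 1)) -
              eisE (p - 1) ^ (t - (m - 1)) * h (s' + j)) ∈ coeffIdeal p m :=
          sum_mem fun j hj => zsmul_mem (hcong _ (by have := Finset.mem_range.1 hj; lia) t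
            (by have := Finset.mem_range.1 hj; lia) ht) _
        have h3 := zsmul_mem (sub_mem h1 h2) ((-1) ^ m)
        convert h3 using 1
        have e : ∑ j ∈ Finset.range m, ((-1) ^ j * (m.choose j : ℤ)) •
            (eisE (p - 1) ^ (t - (s' + j)) * eisG (k + (s' + j) * (p - 1))) =
            eisE (p - 1) ^ (t - (m + s')) * ∑ j ∈ Finset.range m, ((-1) ^ j * (m.choose j : ℤ)) •
            (eisE (p - 1) ^ (m - j) * eisG (k + (s' + j) * (p - 1))) := by
          rw [Finset.mul_sum]
          refine Finset.sum_congr rfl fun j hj => ?_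
          have := Finset.mem_range.1 hj
          rw [mul_smul_comm, ← mul_assoc, ← pow_add]
          congr 4
          lia
        have e' : ∑ j ∈ Finset.range m, ((-1) ^ j * (m.choose j : ℤ)) •
            (eisE (p - 1) ^ (t - (m - 1)) * h (s' + j)) = eisE (p - 1) ^ (t - (m - 1)) *
              ∑ j ∈ Finset.range m, ((-1) ^ j * (m.choose j : ℤ)) • h (s' + j) := by
          rw [Finset.mul_sum]
          exact Finset.sum_congr rfl fun j _ => (mul_smul_comm _ _ _).symm
        simp only [smul_sub, Finset.sum_sub_distrib]
        rw [e, e', add_comm s' m]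
        have hsq : ((-1 : ℚ⟦X⟧) ^ m) * (-1) ^ m = 1 := by
          rw [← mul_pow]
          simp
        simp only [zsmul_eq_mul (_ : ℚ⟦X⟧) (((-1) ^ m : ℤ)),
          zsmul_eq_mul (_ : ℚ⟦X⟧) (((-1) ^ m * ((1 : ℕ) : ℤ) : ℤ))]
        push_cast
        linear_combination (-(eisE (p - 1) ^ (t - (m + s')) * eisG (k + (m + s') * (p - 1)))) * hsq

end Eisenstein

end EisFactor

/-! ### Starting the reduction at k₀(m) -/

theorem corollary1p3 (p m k : ℕ) (hp : p.Prime) (hp5 : 5 ≤ p) (hm : 1 ≤ m)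
    (hk : 4 ≤ k) (hkeven : Even k) (hpk : ¬ (p - 1) ∣ k)
    (hmk : ¬ (m = 1 ∧ k ≡ 2 [MOD (p - 1)])) :
    EisFactor.eisG k ∈ EisFactor.modForms p k ∧
    EisFactor.factorFiltration p m (EisFactor.eisG k) ≤
      (((m - 1) * (p - 1) + EisFactor.kZero p k m : ℕ) : ℕ∞) ∧
    ∃ w : ℕ, w ≤ m * p ∧ ∃ n : ℕ, ∃ g ∈ EisFactor.modForms p w,
      EisFactor.CongMod p m (EisFactor.eisG k) (EisFactor.eisE (p - 1) ^ n * g) := by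
  have : Fact p.Prime := ⟨hp⟩
  have hpe : Even (p - 1) := hp.even_sub_one (by lia)
  have hG := EisFactor.eisG_mem_modForms (p := p) (by lia) (by lia : 3 ≤ k) hkeven hpk
  set k₀ := EisFactor.kZero p k m with hk₀
  -- the residue class of `k` meets every interval of length `p - 1`
  have hex : ∃ j, j ≤ m + (p - 1) ∧ m < j ∧ j ≡ k [MOD (p - 1)] := by
    -- Adding (p-1)(m+1) keeps the natural subtraction from truncating.
    refine ⟨m + 1 + (k + (p - 1) * (m + 1) - (m + 1)) % (p - 1), ?_, ?_, ?_⟩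
    · have := Nat.mod_lt (k + (p - 1) * (m + 1) - (m + 1)) (by lia : 0 < p - 1)
      lia
    · lia
    · have hle : m + 1 ≤ k + (p - 1) * (m + 1) :=
        (Nat.le_mul_of_pos_left _ (by lia)).trans (Nat.le_add_left _ _)
      calc m + 1 + (k + (p - 1) * (m + 1) - (m + 1)) % (p - 1)
          ≡ m + 1 + (k + (p - 1) * (m + 1) - (m + 1)) [MOD (p - 1)] :=
            (Nat.mod_modEq _ _).add_left _
        _ = k + (p - 1) * (m + 1) := Nat.add_sub_cancel' hle
        _ ≡ k [MOD (p - 1)] := by simp [Nat.ModEq]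
  obtain ⟨j, hj, hjm⟩ := hex
  have hmem : m < k₀ ∧ k₀ ≡ k [MOD (p - 1)] :=
    Nat.sInf_mem (s := {j : ℕ | m < j ∧ j ≡ k [MOD (p - 1)]}) ⟨j, hjm⟩
  have hk₀le : k₀ ≤ m + (p - 1) := (Nat.sInf_le hjm).trans hj
  have hW : (m - 1) * (p - 1) + k₀ ≤ m * p := by
    obtain ⟨m, rfl⟩ := Nat.exists_eq_add_of_le' hm
    obtain ⟨p, rfl⟩ := Nat.exists_eq_add_of_le' hp.one_le
    simp only [Nat.add_sub_cancel] at hk₀le ⊢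
    nlinarith
  have hk₀even : Even k₀ := by
    have := hmem.2.of_dvd hpe.two_dvd
    rw [Nat.even_iff] at hkeven ⊢
    exact (show k₀ % 2 = k % 2 from this).trans hkeven
  have hk₀p : ¬ (p - 1) ∣ k₀ := fun h => hpk ((hmem.2.dvd_iff dvd_rfl).1 h)
  -- Since k₀ is even and exceeds m ≥ 1, only k₀ = 2 could fail, forcing the excluded case m = 1, k
  -- ≡ 2.
  have hk₀3 : 3 ≤ k₀ := by
    by_contra! hlt
    have h2 : k₀ = 2 := by
      obtain ⟨l, hl⟩ := hk₀even
      lia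
    refine hmk ⟨by lia, ?_⟩
    rw [← h2]
    exact hmem.2.symm
  obtain ⟨w, hw, n, g, hg, hcong⟩ : ∃ w : ℕ, w ≤ (m - 1) * (p - 1) + k₀ ∧ ∃ n : ℕ,
      ∃ g ∈ EisFactor.modForms p w,
      EisFactor.CongMod p m (EisFactor.eisG k) (EisFactor.eisE (p - 1) ^ n * g) := by
    -- Below the bound G_k itself serves; above it, s ≥ m-1 and the reduction applies with t = s.
    by_cases hkW : k ≤ (m - 1) * (p - 1) + k₀
    · exact ⟨k, hkW, 0, _, hG, EisFactor.congMod_of_sub_mem (by simp)⟩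
    · obtain ⟨s, hs⟩ := (Nat.modEq_iff_dvd' (by lia : k₀ ≤ k)).1 hmem.2
      have hks : k = k₀ + s * (p - 1) := by rw [mul_comm s]; lia
      have hsm : m - 1 ≤ s := by
        by_contra! hlt
        have := Nat.mul_le_mul_right (p - 1) hlt.le
        lia
      obtain ⟨g, hg, hcong⟩ := EisFactor.exists_modForm_congr_eisG hp5 hm hk₀3 hk₀even hk₀p
        hmem.1 s
      have := hcong s le_rfl hsm
      rw [Nat.sub_self, pow_zero, one_mul, ← hks] at this
      exact ⟨_, (Nat.add_comm _ _).le, _, g, hg, EisFactor.congMod_of_sub_mem this⟩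
  have hfilt : EisFactor.factorFiltration p m (EisFactor.eisG k) ≤ (w : ℕ∞) :=
    sInf_le ⟨w, rfl, n, g, hg, hcong⟩
  exact ⟨hG, hfilt.trans (Nat.cast_le.2 hw),
    w, hw.trans hW, n, g, hg, hcong⟩
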